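/- Let $\nu\ge 1$, let $\lambda_1,\dots,\lambda_\nu>0$ and $\rho>0$, and let $B(\rho)=\{x\in\mathbb R^\nu : x^Tx<\rho\}$. Let $X=(X_1,\dots,X_\nu)^T$ be a random vector whose distribution is the normal law $N_\nu(0,\operatorname{diag}(\lambda_1,\dots,\lambda_\nu))$ truncated to $B(\rho)$, i.e. $X$ has the density $$f(x)=k\prod_{n=1}^{\nu}\lambda_n^{-1/2}\phi(\lambda_n^{-1/2}x_n)\ \text{ if } x\in B(\rho),\qquad f(x)=0\ \text{ otherwise,}$$ where $\phi$ is the standard univariate normal density and $k$ is the normalizing constant. Then, for all $1\le n\ne m\le\nu$, the variables $X_n^2$ and $X_m^2$ are square-integrable and $$\operatorname{cov}(X_n^2,X_m^2)\le 0 .$$ -/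

import Mathlib

open MeasureTheory ProbabilityTheory

noncomputable section

/-- The open Euclidean ball `B(ρ) = {x : xᵀ x < ρ}` in `ℝ^ν` (of radius `√ρ`). -/
def truncBall (ν : ℕ) (ρ : ℝ) : Set (Fin ν → ℝ) :=
  {x | x ⬝ᵥ x < ρ}

/-- The density of the normal law with mean zero and covariance `diag(lam_1, …, lam_ν)`:
`∏ₙ lamₙ^(-1/2) φ(lamₙ^(-1/2) xₙ)`, where `φ` is the standard univariate normal density. -/
def diagNormalDensity {ν : ℕ} (lam : Fin ν → ℝ) (x : Fin ν → ℝ) : ℝ :=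
  ∏ n, lam n ^ (-1 / 2 : ℝ) * gaussianPDFReal 0 1 (lam n ^ (-1 / 2 : ℝ) * x n)

/-- The normalizing constant of the normal density truncated to the ball. -/
def truncNormalConst {ν : ℕ} (lam : Fin ν → ℝ) (ρ : ℝ) : ℝ :=
  (∫ x in truncBall ν ρ, diagNormalDensity lam x)⁻¹

open Classical in
/-- The truncated density. -/
def truncNormalDensity {ν : ℕ} (lam : Fin ν → ℝ) (ρ : ℝ) (x : Fin ν → ℝ) : ℝ :=
  if x ∈ truncBall ν ρ then truncNormalConst lam ρ * diagNormalDensity lam x else 0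

/-- The distribution on `ℝ^ν` whose density with respect to Lebesgue measure is the truncated
density. -/
def truncNormal {ν : ℕ} (lam : Fin ν → ℝ) (ρ : ℝ) : Measure (Fin ν → ℝ) :=
  volume.withDensity fun x => ENNReal.ofReal (truncNormalDensity lam ρ x)

theorem isOpen_truncBall (ν : ℕ) (ρ : ℝ) : IsOpen (truncBall ν ρ) := by
  unfold truncBall dotProduct
  exact isOpen_lt (by fun_prop) (by fun_prop)

theorem diagNormalDensity_pos {ν : ℕ} {lam : Fin ν → ℝ} (hlam : ∀ n, 0 < lam n)
    (x : Fin ν → ℝ) : 0 < diagNormalDensity lam x :=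
  Finset.prod_pos fun n _ => mul_pos (Real.rpow_pos_of_pos (hlam n) _)
    (gaussianPDFReal_pos _ _ _ one_ne_zero)

theorem integrable_diagNormalDensity {ν : ℕ} {lam : Fin ν → ℝ} (hlam : ∀ n, 0 < lam n) :
    Integrable (diagNormalDensity lam) :=
  Integrable.fintype_prod (f := fun n t =>
    lam n ^ (-1 / 2 : ℝ) * gaussianPDFReal 0 1 (lam n ^ (-1 / 2 : ℝ) * t)) fun n =>
      ((integrable_gaussianPDFReal 0 1).comp_mul_left'
        (Real.rpow_pos_of_pos (hlam n) _).ne').const_mul _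

/-- The truncated density integrates to one. -/
theorem isProbabilityMeasure_truncNormal {ν : ℕ} {lam : Fin ν → ℝ} (hlam : ∀ n, 0 < lam n)
    {ρ : ℝ} (hρ : 0 < ρ) : IsProbabilityMeasure (truncNormal lam ρ) := by
  have hB := (isOpen_truncBall ν ρ).measurableSet
  have hI := (integrable_diagNormalDensity hlam).integrableOn (s := truncBall ν ρ)
  have hpos : 0 < ∫ x in truncBall ν ρ, diagNormalDensity lam x := by
    rw [setIntegral_pos_iff_support_of_nonneg_ae
      (Filter.Eventually.of_forall fun x => (diagNormalDensity_pos hlam x).le) hI]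
    have hs : Function.support (diagNormalDensity lam) = Set.univ :=
      Set.eq_univ_of_forall fun x => (diagNormalDensity_pos hlam x).ne'
    rw [hs, Set.univ_inter]
    exact (isOpen_truncBall ν ρ).measure_pos _ ⟨0, by simpa [truncBall] using hρ⟩
  constructor
  have hind : (fun x => ENNReal.ofReal (truncNormalDensity lam ρ x)) =
      (truncBall ν ρ).indicator fun x =>
        ENNReal.ofReal (truncNormalConst lam ρ * diagNormalDensity lam x) := by
    classical
    ext x
    by_cases hx : x ∈ truncBall ν ρ <;> simp [truncNormalDensity, hx]
  rw [truncNormal, withDensity_apply _ MeasurableSet.univ, Measure.restrict_univ, hind,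
    lintegral_indicator hB, truncNormalConst, ← ofReal_integral_eq_lintegral_ofReal (hI.const_mul _)
      (Filter.Eventually.of_forall fun x =>
        mul_nonneg (inv_nonneg.2 hpos.le) (diagNormalDensity_pos hlam x).le),
    integral_const_mul, inv_mul_cancel₀ hpos.ne', ENNReal.ofReal_one]

end

/-! Before truncation the coordinates are independent. Integrating out all but two of them shows
that, up to a constant, `(X_n, X_m)` has density `F (ρ - x ^ 2 - y ^ 2)` with respect to a product
of two Gaussians, where `F` is the mass that the remaining coordinates give to a ball, as a function
of the squared radius. `F` is log-concave (`isLogConcave_gaussianBallMass`), by induction on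
dimension: each step integrates out one coordinate, and a Prékopa–Leindler inequality for even
functions decreasing in `|x|` preserves log-concavity. Hence the weight is of reverse rule of order
two in `(x ^ 2, y ^ 2)`, and a Chebyshev-type symmetrisation (`integral_mul_le_of_reverseRule`)
gives the sign of the covariance. -/

/-! ### Brunn–Minkowski and Prékopa–Leindler for symmetric data on the line. -/

theorem volume_le_biSup_abs {A : Set ℝ} :
    volume A ≤ ⨆ x ∈ A, ENNReal.ofReal (2 * |x|) := by
  set S := ⨆ x ∈ A, ENNReal.ofReal (2 * |x|) with hS
  by_cases htop : S = ⊤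
  · rw [htop]; exact le_top
  have hsub : A ⊆ Set.Icc (-(S.toReal / 2)) (S.toReal / 2) := by
    intro x hx
    have h1 : ENNReal.ofReal (2 * |x|) ≤ S :=
      le_iSup₂ (f := fun x (_ : x ∈ A) => ENNReal.ofReal (2 * |x|)) x hx
    have h2 := (ENNReal.ofReal_le_iff_le_toReal htop).1 h1
    exact abs_le.1 (by linarith)
  calc volume A ≤ volume (Set.Icc (-(S.toReal / 2)) (S.toReal / 2)) := measure_mono hsub
    _ = S := by
      rw [Real.volume_Icc, sub_neg_eq_add, add_halves, ENNReal.ofReal_toReal htop]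

/-- A one-dimensional Brunn–Minkowski inequality for sets that are symmetric about the origin. -/
theorem brunnMinkowski_symmetric {A B C : Set ℝ} (hA : A.Nonempty) (hB : B.Nonempty)
    (hC : ∀ x ∈ C, ∀ y, |y| ≤ |x| → y ∈ C) {t : ℝ} (ht0 : 0 < t) (ht1 : t < 1)
    (h : ∀ x ∈ A, ∀ y ∈ B, (1 - t) * |x| + t * |y| ∈ C) :
    ENNReal.ofReal (1 - t) * volume A + ENNReal.ofReal t * volume B ≤ volume C := by
  have hs : 0 < 1 - t := by linarith
  have key : ∀ x ∈ A, ∀ y ∈ B, ENNReal.ofReal (1 - t) * ENNReal.ofReal (2 * |x|) +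
      ENNReal.ofReal t * ENNReal.ofReal (2 * |y|) ≤ volume C := by
    intro x hx y hy
    set z := (1 - t) * |x| + t * |y| with hz
    have hz0 : 0 ≤ z := by positivity
    -- A single pair of points already puts a centred interval of length `2 * z` inside `C`; the
    -- supremum over pairs then suffices.
    have hsub : Set.Icc (-z) z ⊆ C := fun w hw =>
      hC z (h x hx y hy) w (by rw [abs_of_nonneg hz0]; exact abs_le.2 hw)
    refine le_trans (le_of_eq ?_) (measure_mono hsub)
    rw [Real.volume_Icc, ← ENNReal.ofReal_mul hs.le, ← ENNReal.ofReal_mul ht0.le,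
      ← ENNReal.ofReal_add (by positivity) (by positivity)]
    congr 1
    rw [hz]; ring
  calc ENNReal.ofReal (1 - t) * volume A + ENNReal.ofReal t * volume B
      ≤ ENNReal.ofReal (1 - t) * (⨆ x ∈ A, ENNReal.ofReal (2 * |x|)) +
        ENNReal.ofReal t * (⨆ x ∈ B, ENNReal.ofReal (2 * |x|)) := by
        gcongr <;> exact volume_le_biSup_abs
    _ = (⨆ x ∈ A, ENNReal.ofReal (1 - t) * ENNReal.ofReal (2 * |x|)) +
        (⨆ x ∈ B, ENNReal.ofReal t * ENNReal.ofReal (2 * |x|)) := by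
        simp_rw [ENNReal.mul_iSup]
    _ ≤ volume C := ENNReal.biSup_add_biSup_le' hA hB key

/-- The additive form of the Prékopa–Leindler inequality for functions with maximum one at the
origin. -/
theorem prekopaLeindler_additive {f g h : ℝ → ℝ} (hf : Measurable f) (hg : Measurable g)
    (hh : Measurable h) (f0 : 0 ≤ f) (g0 : 0 ≤ g) (h0 : 0 ≤ h)
    (hf1 : ∀ x, f x ≤ 1) (hg1 : ∀ x, g x ≤ 1) (hf' : f 0 = 1) (hg' : g 0 = 1)
    (hmono : ∀ x y, |x| ≤ |y| → h y ≤ h x) {t : ℝ} (ht0 : 0 < t) (ht1 : t < 1)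
    (hfg : ∀ x y, f x ^ (1 - t) * g y ^ t ≤ h ((1 - t) * |x| + t * |y|)) :
    ENNReal.ofReal (1 - t) * (∫⁻ x, ENNReal.ofReal (f x)) +
      ENNReal.ofReal t * (∫⁻ x, ENNReal.ofReal (g x)) ≤ ∫⁻ x, ENNReal.ofReal (h x) := by
  have hm : ∀ q : ℝ → ℝ, Measurable fun s => volume {a | s < q a} := fun q =>
    Antitone.measurable fun s s' hs => measure_mono fun a (ha : s' < q a) => lt_of_le_of_lt hs ha
  rw [lintegral_eq_lintegral_meas_lt _ (.of_forall f0) hf.aemeasurable,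
    lintegral_eq_lintegral_meas_lt _ (.of_forall g0) hg.aemeasurable,
    lintegral_eq_lintegral_meas_lt _ (.of_forall h0) hh.aemeasurable,
    ← lintegral_const_mul _ (hm f), ← lintegral_const_mul _ (hm g),
    ← lintegral_add_left ((hm f).const_mul _)]
  refine setLIntegral_mono (hm h) fun s (hs : 0 < s) => ?_
  -- Layer cake: the superlevel sets of `f` and `g` are compared at the same height. Both contain
  -- `0` below height one and are empty from there on, so the nonemptiness needed by Brunn–Minkowski
  -- is never lost on one side only.
  by_cases hs1 : s < 1
  · refine brunnMinkowski_symmetric ⟨0, by simpa [hf'] using hs1⟩ ⟨0, by simpa [hg'] using hs1⟩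
      (fun x (hx : s < h x) y hy => lt_of_lt_of_le hx (hmono y x hy)) ht0 ht1 ?_
    intro x (hx : s < f x) y (hy : s < g y)
    refine lt_of_lt_of_le ?_ (hfg x y)
    calc s = s ^ (1 - t) * s ^ t := by rw [← Real.rpow_add hs]; simp
      _ < f x ^ (1 - t) * g y ^ t := by
        have := Real.rpow_lt_rpow hs.le hx (by linarith : 0 < 1 - t)
        have := Real.rpow_lt_rpow hs.le hy ht0
        gcongr
  · have h1 : {a | s < f a} = ∅ := by
      ext a; simpa using (hf1 a).trans (not_lt.1 hs1)
    have h2 : {a | s < g a} = ∅ := by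
      ext a; simpa using (hg1 a).trans (not_lt.1 hs1)
    simp [h1, h2]

/-- The Prékopa–Leindler inequality on the line for even functions that decrease away from the
origin. -/
theorem prekopaLeindler_even {f g h : ℝ → ℝ} (hf : Measurable f) (hg : Measurable g)
    (hh : Measurable h) (f0 : 0 ≤ f) (g0 : 0 ≤ g) (h0 : 0 ≤ h)
    (hfi : Integrable f) (hgi : Integrable g) (hhi : Integrable h)
    (hf1 : ∀ x, f x ≤ f 0) (hg1 : ∀ x, g x ≤ g 0)
    (hmono : ∀ x y, |x| ≤ |y| → h y ≤ h x) {t : ℝ} (ht0 : 0 < t) (ht1 : t < 1)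
    (hfg : ∀ x y, f x ^ (1 - t) * g y ^ t ≤ h ((1 - t) * |x| + t * |y|)) :
    (∫ x, f x) ^ (1 - t) * (∫ x, g x) ^ t ≤ ∫ x, h x := by
  have hs : 0 < 1 - t := by linarith
  have hh' : 0 ≤ ∫ x, h x := integral_nonneg h0
  rcases (f0 0).eq_or_lt with hz | hfp
  · have : f = 0 := funext fun x => le_antisymm ((hf1 x).trans hz.ge) (f0 x)
    simpa [this, Real.zero_rpow hs.ne'] using hh'
  rcases (g0 0).eq_or_lt with hz | hgp
  · have : g = 0 := funext fun x => le_antisymm ((hg1 x).trans hz.ge) (g0 x)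
    simpa [this, Real.zero_rpow ht0.ne'] using hh'
  simp only [Pi.zero_apply] at hfp hgp
  have hF : 0 ≤ ∫ x, f x := integral_nonneg f0
  have hG : 0 ≤ ∫ x, g x := integral_nonneg g0
  -- Dividing `h` by the weighted geometric mean of the two peaks preserves the hypothesis. Weighted
  -- AM–GM then turns the additive bound into the multiplicative one, and `c` cancels.
  set c := f 0 ^ (1 - t) * g 0 ^ t with hc
  have hcp : 0 < c := by positivity
  have key := prekopaLeindler_additive (f := fun x => f x / f 0) (g := fun x => g x / g 0)
    (h := fun x => h x / c) (hf.div_const _) (hg.div_const _) (hh.div_const _)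
    (fun x => div_nonneg (f0 x) hfp.le) (fun x => div_nonneg (g0 x) hgp.le)
    (fun x => div_nonneg (h0 x) hcp.le)
    (fun x => (div_le_one hfp).2 (hf1 x)) (fun x => (div_le_one hgp).2 (hg1 x))
    (div_self hfp.ne') (div_self hgp.ne')
    (fun x y hxy => by have := hmono x y hxy; gcongr) ht0 ht1 (fun x y => by
      rw [Real.div_rpow (f0 x) hfp.le, Real.div_rpow (g0 y) hgp.le, div_mul_div_comm]
      have := hfg x y
      gcongr)
  rw [← ofReal_integral_eq_lintegral_ofReal (hfi.div_const _)
      (.of_forall fun x => div_nonneg (f0 x) hfp.le),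
    ← ofReal_integral_eq_lintegral_ofReal (hgi.div_const _)
      (.of_forall fun x => div_nonneg (g0 x) hgp.le),
    ← ofReal_integral_eq_lintegral_ofReal (hhi.div_const _)
      (.of_forall fun x => div_nonneg (h0 x) hcp.le), integral_div, integral_div, integral_div,
    ← ENNReal.ofReal_mul hs.le, ← ENNReal.ofReal_mul ht0.le,
    ← ENNReal.ofReal_add (by positivity) (by positivity),
    ENNReal.ofReal_le_ofReal_iff (by positivity)] at key
  have hgm := Real.geom_mean_le_arith_mean2_weighted hs.le ht0.le
    (div_nonneg hF hfp.le) (div_nonneg hG hgp.le) (by ring)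
  rw [Real.div_rpow hF hfp.le, Real.div_rpow hG hgp.le, div_mul_div_comm] at hgm
  exact (div_le_div_iff_of_pos_right hcp).1 (hgm.trans key)

/-! ### Log-concavity of Gaussian ball masses. -/

/-- Multiplicative (log-)concavity of a real function, with value zero allowed. -/
def IsLogConcave (F : ℝ → ℝ) : Prop :=
  ∀ a b t : ℝ, 0 < t → t < 1 → F a ^ (1 - t) * F b ^ t ≤ F ((1 - t) * a + t * b)

/-- The two inner points are convex combinations of the outer ones with complementary weights, so
multiplying the two log-concavity inequalities leaves total exponent one on each outer value. This
is the source of the reverse rule. -/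
theorem IsLogConcave.map_mul_map_le {F : ℝ → ℝ} (hF : IsLogConcave F) (h0 : 0 ≤ F) {a p q : ℝ}
    (hp : 0 ≤ p) (hq : 0 ≤ q) : F a * F (a + p + q) ≤ F (a + p) * F (a + q) := by
  rcases hp.eq_or_lt with rfl | hp
  · simp
  rcases hq.eq_or_lt with rfl | hq
  · simp [mul_comm]
  have split : ∀ x s : ℝ, 0 ≤ x → x = x ^ (1 - s) * x ^ s := by
    intro x s hx
    rw [← Real.rpow_add' hx (by simp)]; simp
  set t := p / (p + q) with ht
  have ht0 : 0 < t := by positivity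
  have ht1 : t < 1 := by rw [ht, div_lt_one (by positivity)]; linarith
  have h1 := hF a (a + p + q) t ht0 ht1
  have h2 := hF a (a + p + q) (1 - t) (by linarith) (by linarith)
  have e1 : (1 - t) * a + t * (a + p + q) = a + p := by rw [ht]; field_simp; ring
  have e2 : (1 - (1 - t)) * a + (1 - t) * (a + p + q) = a + q := by rw [ht]; field_simp; ring
  rw [e1] at h1
  rw [e2] at h2
  have n1 := h0 a
  have n2 := h0 (a + p + q)
  simp only [Pi.zero_apply] at n1 n2
  calc F a * F (a + p + q)
      = (F a ^ (1 - t) * F a ^ t) * (F (a + p + q) ^ (1 - t) * F (a + p + q) ^ t) := by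
        rw [← split _ _ n1, ← split _ _ n2]
    _ = (F a ^ (1 - t) * F (a + p + q) ^ t) *
        (F a ^ (1 - (1 - t)) * F (a + p + q) ^ (1 - t)) := by
        rw [sub_sub_cancel]; ring
    _ ≤ F (a + p) * F (a + q) := mul_le_mul h1 h2 (by positivity) (h0 _)

theorem gaussianPDFReal_zero_anti (v : NNReal) {x y : ℝ} (h : |x| ≤ |y|) :
    gaussianPDFReal 0 v y ≤ gaussianPDFReal 0 v x := by
  have := sq_le_sq.2 h
  simp only [gaussianPDFReal, sub_zero]
  gcongr

theorem gaussianPDFReal_zero_logConcave (v : NNReal) (x y : ℝ) {t : ℝ} (ht0 : 0 < t)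
    (ht1 : t < 1) : gaussianPDFReal 0 v x ^ (1 - t) * gaussianPDFReal 0 v y ^ t ≤
      gaussianPDFReal 0 v ((1 - t) * x + t * y) := by
  simp only [gaussianPDFReal, sub_zero]
  set c := (√(2 * Real.pi * v))⁻¹ with hc
  have hc0 : 0 ≤ c := by positivity
  rw [Real.mul_rpow hc0 (Real.exp_nonneg _), Real.mul_rpow hc0 (Real.exp_nonneg _),
    ← Real.exp_mul, ← Real.exp_mul, mul_mul_mul_comm, ← Real.rpow_add' hc0 (by simp),
    ← Real.exp_add, sub_add_cancel, Real.rpow_one]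
  refine mul_le_mul_of_nonneg_left (Real.exp_le_exp.2 ?_) hc0
  have : ((1 - t) * x + t * y) ^ 2 ≤ (1 - t) * x ^ 2 + t * y ^ 2 := by
    nlinarith [mul_nonneg (mul_nonneg ht0.le (sub_nonneg.2 ht1.le)) (sq_nonneg (x - y))]
  calc -x ^ 2 / (2 * v) * (1 - t) + -y ^ 2 / (2 * v) * t
      = -((1 - t) * x ^ 2 + t * y ^ 2) / (2 * v) := by ring
    _ ≤ _ := by gcongr

/-- The integrand is jointly log-concave in `(r, x)`, because `r - x ^ 2` is concave and `F` is
increasing and log-concave. It is also even and decreasing in `|x|`, so the symmetric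
Prékopa–Leindler inequality applies. -/
theorem IsLogConcave.integral_gaussian {F : ℝ → ℝ} (hF : IsLogConcave F) (h0 : 0 ≤ F)
    (h1 : ∀ r, F r ≤ 1) (hmono : Monotone F) {v : NNReal} (hv : v ≠ 0) :
    IsLogConcave fun r => ∫ x, F (r - x ^ 2) ∂gaussianReal 0 v := by
  intro a b t ht0 ht1
  have hs : 0 < 1 - t := by linarith
  have hφ := gaussianPDFReal_nonneg 0 v
  set f : ℝ → ℝ → ℝ := fun r x => gaussianPDFReal 0 v x * F (r - x ^ 2) with hf
  have hmeas : ∀ r, Measurable (f r) := fun r => (measurable_gaussianPDFReal 0 v).mul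
    (hmono.measurable.comp (by fun_prop))
  have hnn : ∀ r, 0 ≤ f r := fun r x => mul_nonneg (hφ x) (h0 _)
  have hint : ∀ r, Integrable (f r) := fun r =>
    (integrable_gaussianPDFReal 0 v).mono' (hmeas r).aestronglyMeasurable
      (.of_forall fun x => by
        rw [Real.norm_of_nonneg (hnn r x)]
        exact mul_le_of_le_one_right (hφ x) (h1 _))
  have hanti : ∀ r x y, |x| ≤ |y| → f r y ≤ f r x := fun r x y hxy =>
    mul_le_mul (gaussianPDFReal_zero_anti v hxy)
      (hmono (by have := sq_le_sq.2 hxy; linarith)) (h0 _) (hφ x)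
  have e : ∀ r, ∫ x, F (r - x ^ 2) ∂gaussianReal 0 v = ∫ x, f r x := fun r => by
    rw [integral_gaussianReal_eq_integral_smul hv]; rfl
  simp only [e]
  refine prekopaLeindler_even (hmeas a) (hmeas b) (hmeas _) (hnn _) (hnn _) (hnn _)
    (hint _) (hint _) (hint _) (fun x => hanti a 0 x (by simp)) (fun x => hanti b 0 x (by simp))
    (hanti _) ht0 ht1 fun x y => ?_
  have hsq : ((1 - t) * |x| + t * |y|) ^ 2 ≤ (1 - t) * x ^ 2 + t * y ^ 2 := by
    nlinarith [mul_nonneg (mul_nonneg ht0.le (sub_nonneg.2 ht1.le)) (sq_nonneg (|x| - |y|)),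
      sq_abs x, sq_abs y]
  calc f a x ^ (1 - t) * f b y ^ t
      = (gaussianPDFReal 0 v |x| ^ (1 - t) * gaussianPDFReal 0 v |y| ^ t) *
        (F (a - x ^ 2) ^ (1 - t) * F (b - y ^ 2) ^ t) := by
        have ex : ∀ x, gaussianPDFReal 0 v |x| = gaussianPDFReal 0 v x := fun x => by
          simp [gaussianPDFReal]
        rw [ex, ex, hf]
        simp only
        rw [Real.mul_rpow (hφ x) (h0 _), Real.mul_rpow (hφ y) (h0 _)]
        ring
    _ ≤ gaussianPDFReal 0 v ((1 - t) * |x| + t * |y|) *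
        F ((1 - t) * a + t * b - ((1 - t) * |x| + t * |y|) ^ 2) := by
        have i1 := gaussianPDFReal_zero_logConcave v |x| |y| ht0 ht1
        have i2 := (hF (a - x ^ 2) (b - y ^ 2) t ht0 ht1).trans
          (hmono (by linarith : _ ≤ (1 - t) * a + t * b - ((1 - t) * |x| + t * |y|) ^ 2))
        exact mul_le_mul i1 i2
          (mul_nonneg (Real.rpow_nonneg (h0 _) _) (Real.rpow_nonneg (h0 _) _)) (hφ _)

theorem lintegral_pi_insertNth {k : ℕ} (μ : Fin (k + 1) → Measure ℝ) [∀ i, SigmaFinite (μ i)]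
    (p : Fin (k + 1)) {H : (Fin (k + 1) → ℝ) → ENNReal} (hH : Measurable H) :
    ∫⁻ z, H z ∂Measure.pi μ =
      ∫⁻ x, ∫⁻ y, H (p.insertNth (α := fun _ => ℝ) x y)
        ∂Measure.pi (fun i => μ (p.succAbove i)) ∂μ p := by
  have e := (measurePreserving_piFinSuccAbove μ p).symm
  rw [← e.lintegral_comp hH, lintegral_prod]
  · rfl
  · exact (hH.comp e.measurable).aemeasurable

/-- Since `r` is a squared radius, slicing only shifts it by `x ^ 2`; every Fubini step below stays
within the same family of balls. -/
theorem insertNth_mem_truncBall {k : ℕ} (p : Fin (k + 1)) (x : ℝ) (y : Fin k → ℝ) (r : ℝ) :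
    p.insertNth (α := fun _ => ℝ) x y ∈ truncBall (k + 1) r ↔ y ∈ truncBall k (r - x ^ 2) := by
  have h : p.insertNth (α := fun _ => ℝ) x y ⬝ᵥ p.insertNth (α := fun _ => ℝ) x y =
      x ^ 2 + y ⬝ᵥ y := by
    simp only [dotProduct, Fin.sum_univ_succAbove _ p, Fin.insertNth_apply_same,
      Fin.insertNth_apply_succAbove, pow_two]
  change _ < r ↔ _ < r - x ^ 2
  rw [h, lt_sub_iff_add_lt']

/-- The mass of a ball under a centred Gaussian product measure. -/
noncomputable def gaussianBallMass {k : ℕ} (v : Fin k → NNReal) (r : ℝ) : ℝ :=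
  (Measure.pi fun i => gaussianReal 0 (v i)).real (truncBall k r)

theorem gaussianBallMass_mono {k : ℕ} (v : Fin k → NNReal) : Monotone (gaussianBallMass v) :=
  fun _ _ h => measureReal_mono fun _ hx => lt_of_lt_of_le hx h

theorem gaussianBallMass_nonneg {k : ℕ} (v : Fin k → NNReal) : 0 ≤ gaussianBallMass v :=
  fun _ => measureReal_nonneg

theorem gaussianBallMass_le_one {k : ℕ} (v : Fin k → NNReal) (r : ℝ) :
    gaussianBallMass v r ≤ 1 := measureReal_le_one

theorem ofReal_gaussianBallMass {k : ℕ} (v : Fin k → NNReal) (r : ℝ) :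
    ENNReal.ofReal (gaussianBallMass v r) =
      (Measure.pi fun i => gaussianReal 0 (v i)) (truncBall k r) :=
  ofReal_measureReal

theorem gaussianBallMass_of_nonpos {k : ℕ} (v : Fin k → NNReal) {r : ℝ} (hr : r ≤ 0) :
    gaussianBallMass v r = 0 := by
  have : truncBall k r = ∅ := by
    ext x
    have h : 0 ≤ x ⬝ᵥ x := Finset.sum_nonneg fun i _ => mul_self_nonneg (x i)
    simpa [truncBall] using hr.trans h
  simp [gaussianBallMass, this]

theorem setLIntegral_truncBall_comp_apply {k : ℕ} (v : Fin (k + 1) → NNReal) (p : Fin (k + 1))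
    (r : ℝ) {g : ℝ → (Fin k → ℝ) → ENNReal} (hg : Measurable (Function.uncurry g)) :
    ∫⁻ z in truncBall (k + 1) r, g (z p) (fun i => z (p.succAbove i))
        ∂Measure.pi (fun i => gaussianReal 0 (v i)) =
      ∫⁻ x, ∫⁻ y in truncBall k (r - x ^ 2), g x y
        ∂Measure.pi (fun i => gaussianReal 0 (v (p.succAbove i))) ∂gaussianReal 0 (v p) := by
  have hB := (isOpen_truncBall (k + 1) r).measurableSet
  rw [← lintegral_indicator hB, lintegral_pi_insertNth _ p]
  · refine lintegral_congr fun x => ?_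
    rw [← lintegral_indicator (isOpen_truncBall k _).measurableSet]
    refine lintegral_congr fun y => ?_
    by_cases hy : y ∈ truncBall k (r - x ^ 2)
    · rw [Set.indicator_of_mem hy,
        Set.indicator_of_mem ((insertNth_mem_truncBall p x y r).2 hy)]
      simp only [Fin.insertNth_apply_same, Fin.insertNth_apply_succAbove]
    · rw [Set.indicator_of_notMem hy,
        Set.indicator_of_notMem (mt (insertNth_mem_truncBall p x y r).1 hy)]
  · exact Measurable.indicator (hg.comp (f := fun z : Fin (k + 1) → ℝ =>
      (z p, fun i => z (p.succAbove i))) (by fun_prop)) hB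

theorem gaussianBallMass_succ {k : ℕ} (v : Fin (k + 1) → NNReal) (r : ℝ) :
    gaussianBallMass v r =
      ∫ x, gaussianBallMass (fun i => v (Fin.succAbove 0 i)) (r - x ^ 2)
        ∂gaussianReal 0 (v 0) := by
  rw [integral_eq_lintegral_of_nonneg_ae
    (f := fun x => gaussianBallMass (fun i => v (Fin.succAbove 0 i)) (r - x ^ 2)) (.of_forall fun x => gaussianBallMass_nonneg
      (fun i => v (Fin.succAbove 0 i)) (r - x ^ 2))
    ((gaussianBallMass_mono _).measurable.comp (by fun_prop)).aestronglyMeasurable]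
  simp_rw [ofReal_gaussianBallMass]
  have := setLIntegral_truncBall_comp_apply v 0 r (g := fun _ _ => 1) measurable_const
  simp only [setLIntegral_one] at this
  rw [← this]; rfl

theorem isLogConcave_gaussianBallMass {k : ℕ} (v : Fin k → NNReal) (hv : ∀ i, v i ≠ 0) :
    IsLogConcave (gaussianBallMass v) := by
  induction k with
  | zero =>
    -- In dimension zero the mass is the indicator of `r > 0`; a zero factor stays zero because its
    -- exponent is positive.
    intro a b t ht0 ht1
    rcases le_or_gt a 0 with ha | ha
    · rw [gaussianBallMass_of_nonpos v ha, Real.zero_rpow (by linarith), zero_mul]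
      exact gaussianBallMass_nonneg _ _
    rcases le_or_gt b 0 with hb | hb
    · rw [gaussianBallMass_of_nonpos v hb, Real.zero_rpow (by linarith), mul_zero]
      exact gaussianBallMass_nonneg _ _
    have one : ∀ r, 0 < r → gaussianBallMass v r = 1 := by
      intro r hr
      have : truncBall 0 r = Set.univ := by ext x; simpa [truncBall] using hr
      simp [gaussianBallMass, this]
    have hs : 0 < 1 - t := by linarith
    rw [one a ha, one b hb, one _ (by positivity)]
    simp
  | succ k ih =>
    have := (ih (fun i => v (Fin.succAbove 0 i)) fun i => hv _).integral_gaussian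
      (gaussianBallMass_nonneg _) (gaussianBallMass_le_one _) (gaussianBallMass_mono _) (hv 0)
    simpa only [← gaussianBallMass_succ] using this

/-! ### Two-coordinate marginals and the reverse-rule inequality. -/

/-- Marginal law of two coordinates of a Gaussian product measure restricted to a ball. -/
theorem map_restrict_truncBall {k : ℕ} (v : Fin (k + 2) → NNReal) (p : Fin (k + 2))
    (q : Fin (k + 1)) (r : ℝ) :
    ((Measure.pi fun i => gaussianReal 0 (v i)).restrict (truncBall (k + 2) r)).map
        (fun z => (z p, z (p.succAbove q))) =
      ((gaussianReal 0 (v p)).prod (gaussianReal 0 (v (p.succAbove q)))).withDensity fun z =>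
        ENNReal.ofReal (gaussianBallMass (fun i => v (p.succAbove (q.succAbove i)))
          (r - z.1 ^ 2 - z.2 ^ 2)) := by
  have hw : Measurable fun z : ℝ × ℝ => ENNReal.ofReal
      (gaussianBallMass (fun i => v (p.succAbove (q.succAbove i))) (r - z.1 ^ 2 - z.2 ^ 2)) :=
    ((gaussianBallMass_mono _).measurable.comp (by fun_prop)).ennreal_ofReal
  refine Measure.ext_of_lintegral _ fun g hg => ?_
  rw [lintegral_map hg (by fun_prop), lintegral_withDensity_eq_lintegral_mul _ hw hg,
    lintegral_prod _ (hw.mul hg).aemeasurable,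
    setLIntegral_truncBall_comp_apply v p r (g := fun x y => g (x, y q))
      (hg.comp (f := fun z : ℝ × (Fin (k + 1) → ℝ) => (z.1, z.2 q)) (by fun_prop))]
  refine lintegral_congr fun x => ?_
  rw [setLIntegral_truncBall_comp_apply (fun i => v (p.succAbove i)) q _
      (g := fun y _ => g (x, y)) (hg.comp (f := fun z : ℝ × (Fin k → ℝ) => (x, z.1))
        (by fun_prop))]
  refine lintegral_congr fun y => ?_
  rw [setLIntegral_const, Pi.mul_apply, ofReal_gaussianBallMass, mul_comm]

/-- Exchanging the second components of two independent pairs preserves the product measure. -/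
theorem measurePreserving_exchange_snd {α β : Type*} [MeasurableSpace α] [MeasurableSpace β]
    (μ : Measure α) (ν : Measure β) [SFinite μ] [SFinite ν] :
    MeasurePreserving (fun z : (α × β) × (α × β) => ((z.1.1, z.2.2), (z.2.1, z.1.2)))
      ((μ.prod ν).prod (μ.prod ν)) ((μ.prod ν).prod (μ.prod ν)) := by
  have inner : MeasurePreserving (fun z : β × (α × β) => (z.2.2, (z.2.1, z.1)))
      (ν.prod (μ.prod ν)) (ν.prod (μ.prod ν)) := by
    have h1 : MeasurePreserving (Prod.swap : β × (α × β) → (α × β) × β) (ν.prod (μ.prod ν))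
      ((μ.prod ν).prod ν) := Measure.measurePreserving_swap
    have h2 := measurePreserving_prodAssoc μ ν ν
    have h3 : MeasurePreserving (Prod.map id Prod.swap : α × (β × β) → α × (β × β))
        (μ.prod (ν.prod ν)) (μ.prod (ν.prod ν)) :=
      (MeasurePreserving.id μ).prod Measure.measurePreserving_swap
    have h4 := h2.symm
    have h5 : MeasurePreserving (Prod.swap : (α × β) × β → β × (α × β)) ((μ.prod ν).prod ν)
      (ν.prod (μ.prod ν)) := Measure.measurePreserving_swap
    exact h5.comp (h4.comp (h3.comp (h2.comp h1)))
  have o1 := measurePreserving_prodAssoc μ ν (μ.prod ν)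
  exact o1.symm.comp (((MeasurePreserving.id μ).prod inner).comp o1)

/-- A Chebyshev-type inequality for a weight of reverse rule of order two. -/
theorem integral_mul_le_of_reverseRule {α β : Type*} [MeasurableSpace α] [MeasurableSpace β]
    (μ : Measure α) (ν : Measure β) [SFinite μ] [SFinite ν] {w : α × β → ℝ} {u : α → ℝ}
    {v : β → ℝ} (hw : Integrable w (μ.prod ν))
    (hwu : Integrable (fun z => w z * u z.1) (μ.prod ν))
    (hwv : Integrable (fun z => w z * v z.2) (μ.prod ν))
    (hwuv : Integrable (fun z => w z * (u z.1 * v z.2)) (μ.prod ν))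
    (hrr : ∀ x x' y y', (u x - u x') * (v y - v y') *
      (w (x, y) * w (x', y') - w (x, y') * w (x', y)) ≤ 0) :
    (∫ z, w z ∂μ.prod ν) * (∫ z, w z * (u z.1 * v z.2) ∂μ.prod ν) ≤
      (∫ z, w z * u z.1 ∂μ.prod ν) * (∫ z, w z * v z.2 ∂μ.prod ν) := by
  set π := μ.prod ν with hπ
  -- Over two independent copies, `Φ` integrates to twice the difference of the two sides. Adding
  -- its image under the exchange of second components flips the sign of the `v` factor and yields
  -- exactly the expression in `hrr`.
  set Φ : (α × β) × (α × β) → ℝ := fun z =>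
    (u z.1.1 - u z.2.1) * (v z.1.2 - v z.2.2) * (w z.1 * w z.2) with hΦ
  have i1 := hwuv.mul_prod hw
  have i2 := hw.mul_prod hwuv
  have i3 := hwu.mul_prod hwv
  have i4 := hwv.mul_prod hwu
  have hΦ' : Φ = ((fun z => w z.1 * (u z.1.1 * v z.1.2) * w z.2) +
      fun z => w z.1 * (w z.2 * (u z.2.1 * v z.2.2))) -
      ((fun z => w z.1 * u z.1.1 * (w z.2 * v z.2.2)) +
        fun z => w z.1 * v z.1.2 * (w z.2 * u z.2.1)) := by
    funext z; simp only [hΦ, Pi.add_apply, Pi.sub_apply]; ring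
  have hΦi : Integrable Φ (π.prod π) := by
    rw [hΦ']; exact (i1.add i2).sub (i3.add i4)
  have hval : ∫ z, Φ z ∂π.prod π = 2 * ((∫ z, w z ∂π) * (∫ z, w z * (u z.1 * v z.2) ∂π) -
      (∫ z, w z * u z.1 ∂π) * (∫ z, w z * v z.2 ∂π)) := by
    rw [hΦ', integral_sub' (i1.add i2) (i3.add i4), integral_add' i1 i2, integral_add' i3 i4,
      integral_prod_mul (fun z : α × β => w z * (u z.1 * v z.2)) w,
      integral_prod_mul w (fun z : α × β => w z * (u z.1 * v z.2)),
      integral_prod_mul (fun z : α × β => w z * u z.1) (fun z => w z * v z.2),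
      integral_prod_mul (fun z : α × β => w z * v z.2) (fun z => w z * u z.1)]
    ring
  have hσ := measurePreserving_exchange_snd μ ν
  have hΦσ : ∫ z, Φ ((z.1.1, z.2.2), (z.2.1, z.1.2)) ∂π.prod π = ∫ z, Φ z ∂π.prod π := by
    have := integral_map (f := Φ) hσ.measurable.aemeasurable
      (by rw [hσ.map_eq]; exact hΦi.aestronglyMeasurable)
    rw [hσ.map_eq] at this
    exact this.symm
  have hΦσi : Integrable (fun z => Φ ((z.1.1, z.2.2), (z.2.1, z.1.2))) (π.prod π) :=
    hσ.integrable_comp_of_integrable hΦi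
  have hsum : ∫ z, (Φ z + Φ ((z.1.1, z.2.2), (z.2.1, z.1.2))) ∂π.prod π ≤ 0 := by
    refine integral_nonpos fun z => ?_
    have := hrr z.1.1 z.2.1 z.1.2 z.2.2
    simp only [hΦ, Pi.zero_apply]
    linarith
  rw [integral_add hΦi hΦσi, hΦσ, hval] at hsum
  linarith

/-! ### The truncated law as a restricted Gaussian product measure. -/

theorem pi_withDensity_ofReal {ι : Type*} [Fintype ι] {f : ι → ℝ → ℝ} (hf : ∀ i, 0 ≤ f i)
    (hfi : ∀ i, Integrable (f i)) :
    Measure.pi (fun i => (volume : Measure ℝ).withDensity fun x => ENNReal.ofReal (f i x)) =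
      (volume : Measure (ι → ℝ)).withDensity fun x => ENNReal.ofReal (∏ i, f i (x i)) := by
  have := fun i => isFiniteMeasure_withDensity_ofReal (hfi i).2
  refine Measure.pi_eq fun s hs => ?_
  have hsm : MeasurableSet (Set.univ.pi s) := MeasurableSet.univ_pi hs
  have hint : Integrable (fun x : ι → ℝ => ∏ i, f i (x i)) := Integrable.fintype_prod hfi
  rw [withDensity_apply _ hsm, ← ofReal_integral_eq_lintegral_ofReal hint.integrableOn
      (.of_forall fun x => Finset.prod_nonneg fun i _ => hf i _), volume_pi,
    Measure.restrict_pi_pi, integral_fintype_prod_eq_prod,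
    ENNReal.ofReal_prod_of_nonneg fun i _ => integral_nonneg (hf i)]
  refine Finset.prod_congr rfl fun i _ => ?_
  rw [withDensity_apply _ (hs i), ofReal_integral_eq_lintegral_ofReal (hfi i).integrableOn
    (.of_forall (hf i))]

theorem gaussianPDFReal_toNNReal {l : ℝ} (hl : 0 < l) (x : ℝ) :
    gaussianPDFReal 0 l.toNNReal x =
      l ^ (-1 / 2 : ℝ) * gaussianPDFReal 0 1 (l ^ (-1 / 2 : ℝ) * x) := by
  have e : l ^ (-1 / 2 : ℝ) = (√l)⁻¹ := by
    rw [Real.sqrt_eq_rpow, ← Real.rpow_neg hl.le]; norm_num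
  have hs : (√l)⁻¹ ^ 2 = l⁻¹ := by rw [inv_pow, Real.sq_sqrt hl.le]
  simp only [gaussianPDFReal, sub_zero, Real.coe_toNNReal l hl.le, NNReal.coe_one, mul_one]
  rw [e, mul_pow, hs, Real.sqrt_mul (by positivity) l, mul_inv, ← mul_assoc,
    mul_comm (√l)⁻¹]
  congr 2
  field_simp

theorem pi_gaussianReal_eq_withDensity {ν : ℕ} {lam : Fin ν → ℝ} (hlam : ∀ n, 0 < lam n) :
    Measure.pi (fun n => gaussianReal 0 (lam n).toNNReal) =
      volume.withDensity fun x => ENNReal.ofReal (diagNormalDensity lam x) := by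
  have h : ∀ n, gaussianReal 0 (lam n).toNNReal = (volume : Measure ℝ).withDensity fun x =>
      ENNReal.ofReal (gaussianPDFReal 0 (lam n).toNNReal x) := fun n =>
    gaussianReal_of_var_ne_zero 0 (by simpa using hlam n)
  simp_rw [h]
  rw [pi_withDensity_ofReal (fun n => gaussianPDFReal_nonneg _ _)
    fun n => integrable_gaussianPDFReal _ _]
  simp_rw [gaussianPDFReal_toNNReal (hlam _)]
  rfl

theorem truncNormal_eq_smul_restrict {ν : ℕ} {lam : Fin ν → ℝ} (hlam : ∀ n, 0 < lam n)
    (ρ : ℝ) : truncNormal lam ρ = ENNReal.ofReal (truncNormalConst lam ρ) •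
      (Measure.pi fun n => gaussianReal 0 (lam n).toNNReal).restrict (truncBall ν ρ) := by
  have hc : 0 ≤ truncNormalConst lam ρ :=
    inv_nonneg.2 (integral_nonneg fun x => (diagNormalDensity_pos hlam x).le)
  have hB := (isOpen_truncBall ν ρ).measurableSet
  have hind : (fun x => ENNReal.ofReal (truncNormalDensity lam ρ x)) =
      (truncBall ν ρ).indicator (ENNReal.ofReal (truncNormalConst lam ρ) •
        fun x => ENNReal.ofReal (diagNormalDensity lam x)) := by
    classical
    ext x
    by_cases hx : x ∈ truncBall ν ρ <;> simp [truncNormalDensity, hx, ENNReal.ofReal_mul hc]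
  rw [truncNormal, hind, withDensity_indicator hB,
    withDensity_smul' _ _ ENNReal.ofReal_ne_top, pi_gaussianReal_eq_withDensity hlam,
    restrict_withDensity hB]

theorem sq_le_of_mem_truncBall {ν : ℕ} {ρ : ℝ} {x : Fin ν → ℝ} (hx : x ∈ truncBall ν ρ)
    (n : Fin ν) : x n ^ 2 ≤ ρ := by
  refine le_trans ?_ (le_of_lt hx)
  rw [pow_two]
  exact Finset.single_le_sum (f := fun i => x i * x i) (fun i _ => mul_self_nonneg (x i))
    (Finset.mem_univ n)

theorem memLp_sq_truncNormal {ν : ℕ} {lam : Fin ν → ℝ} (hlam : ∀ n, 0 < lam n) {ρ : ℝ}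
    (hρ : 0 < ρ) (n : Fin ν) : MemLp (fun x => x n ^ 2) 2 (truncNormal lam ρ) := by
  have := isProbabilityMeasure_truncNormal hlam hρ
  refine MemLp.of_bound ((measurable_pi_apply n).pow_const 2).aestronglyMeasurable ρ ?_
  rw [truncNormal_eq_smul_restrict hlam]
  refine Measure.ae_smul_measure ?_ _
  filter_upwards [ae_restrict_mem (isOpen_truncBall ν ρ).measurableSet] with x hx
  rw [Real.norm_of_nonneg (sq_nonneg _)]
  exact sq_le_of_mem_truncBall hx n

/-! ### Negative correlation of the squares. -/

/-- The squares of two coordinates are negatively correlated under the weight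
`F (ρ - x² - y²)`. -/
theorem integral_sq_mul_sq_le {F : ℝ → ℝ} (hF : IsLogConcave F) (h0 : 0 ≤ F)
    (h1 : ∀ r, F r ≤ 1) (hmono : Monotone F) (hneg : ∀ r ≤ 0, F r = 0) {ρ : ℝ} (hρ : 0 ≤ ρ)
    (μ ν : Measure ℝ) [IsFiniteMeasure μ] [IsFiniteMeasure ν] :
    (∫ z, F (ρ - z.1 ^ 2 - z.2 ^ 2) ∂μ.prod ν) *
        (∫ z, F (ρ - z.1 ^ 2 - z.2 ^ 2) * (z.1 ^ 2 * z.2 ^ 2) ∂μ.prod ν) ≤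
      (∫ z, F (ρ - z.1 ^ 2 - z.2 ^ 2) * z.1 ^ 2 ∂μ.prod ν) *
        (∫ z, F (ρ - z.1 ^ 2 - z.2 ^ 2) * z.2 ^ 2 ∂μ.prod ν) := by
  have hm : Measurable fun z : ℝ × ℝ => F (ρ - z.1 ^ 2 - z.2 ^ 2) :=
    hmono.measurable.comp (by fun_prop)
  have hint : ∀ (h : ℝ × ℝ → ℝ) (C : ℝ), Measurable h → 0 ≤ h → 0 ≤ C →
      (∀ z : ℝ × ℝ, z.1 ^ 2 ≤ ρ → z.2 ^ 2 ≤ ρ → h z ≤ C) →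
      Integrable (fun z => F (ρ - z.1 ^ 2 - z.2 ^ 2) * h z) (μ.prod ν) := by
    intro h C hh hh0 hC hb
    refine Integrable.of_bound (hm.mul hh).aestronglyMeasurable C (.of_forall fun z => ?_)
    rw [Real.norm_of_nonneg (mul_nonneg (h0 _) (hh0 z))]
    -- The weight vanishes outside the disc, so a bound on `h` for squares at most `ρ` is enough.
    rcases le_or_gt (ρ - z.1 ^ 2 - z.2 ^ 2) 0 with hz | hz
    · rw [hneg _ hz, zero_mul]; exact hC
    · exact (mul_le_of_le_one_left (hh0 z) (h1 _)).trans
        (hb z (by nlinarith [sq_nonneg z.2]) (by nlinarith [sq_nonneg z.1]))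
  refine integral_mul_le_of_reverseRule μ ν (w := fun z => F (ρ - z.1 ^ 2 - z.2 ^ 2))
    (u := fun x => x ^ 2) (v := fun y => y ^ 2) ?_ ?_ ?_ ?_ ?_
  · simpa using hint (fun _ => 1) 1 measurable_const (fun _ => zero_le_one) zero_le_one
      fun _ _ _ => le_rfl
  · exact hint (fun z => z.1 ^ 2) ρ (by fun_prop) (fun z => sq_nonneg _) hρ fun z h _ => h
  · exact hint (fun z => z.2 ^ 2) ρ (by fun_prop) (fun z => sq_nonneg _) hρ fun z _ h => h
  · exact hint (fun z => z.1 ^ 2 * z.2 ^ 2) (ρ * ρ) (by fun_prop) (fun z => by positivity)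
      (by positivity) fun z h h' => mul_le_mul h h' (sq_nonneg _) hρ
  -- With `s`, `r` standing for the squares, the four arguments of `F` form a pattern `a`, `a + p`,
  -- `a + q`, `a + p + q`. The cases below only track the signs of the differences.
  · have key : ∀ s s' r r' : ℝ, s' ≤ s → r' ≤ r →
        F (ρ - s - r) * F (ρ - s' - r') ≤ F (ρ - s - r') * F (ρ - s' - r) := by
      intro s s' r r' hs hr
      have := hF.map_mul_map_le h0 (a := ρ - s - r) (sub_nonneg.2 hs) (sub_nonneg.2 hr)
      rw [show ρ - s - r + (s - s') + (r - r') = ρ - s' - r' by ring,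
        show ρ - s - r + (s - s') = ρ - s' - r by ring,
        show ρ - s - r + (r - r') = ρ - s - r' by ring] at this
      linarith
    intro x x' y y'
    rcases le_total (x' ^ 2) (x ^ 2) with hx | hx <;> rcases le_total (y' ^ 2) (y ^ 2) with hy | hy
    · exact mul_nonpos_of_nonneg_of_nonpos (mul_nonneg (by linarith) (by linarith))
        (by linarith [key _ _ _ _ hx hy])
    · exact mul_nonpos_of_nonpos_of_nonneg
        (mul_nonpos_of_nonneg_of_nonpos (by linarith) (by linarith))
        (by linarith [key _ _ _ _ hx hy])
    · exact mul_nonpos_of_nonpos_of_nonneg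
        (mul_nonpos_of_nonpos_of_nonneg (by linarith) (by linarith))
        (by linarith [key _ _ _ _ hx hy])
    · exact mul_nonpos_of_nonneg_of_nonpos
        (mul_nonneg_of_nonpos_of_nonpos (by linarith) (by linarith))
        (by linarith [key _ _ _ _ hx hy])

theorem integral_truncNormal_comp {k : ℕ} {lam : Fin (k + 2) → ℝ} (hlam : ∀ n, 0 < lam n)
    {ρ : ℝ} (p : Fin (k + 2)) (q : Fin (k + 1)) {g : ℝ × ℝ → ℝ} (hg : Measurable g) :
    ∫ x, g (x p, x (p.succAbove q)) ∂truncNormal lam ρ =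
      (ENNReal.ofReal (truncNormalConst lam ρ)).toReal *
        ∫ z, gaussianBallMass (fun i => (lam (p.succAbove (q.succAbove i))).toNNReal)
          (ρ - z.1 ^ 2 - z.2 ^ 2) * g z
          ∂(gaussianReal 0 (lam p).toNNReal).prod
            (gaussianReal 0 (lam (p.succAbove q)).toNNReal) := by
  have hw : Measurable fun z : ℝ × ℝ => ENNReal.ofReal
      (gaussianBallMass (fun i => (lam (p.succAbove (q.succAbove i))).toNNReal)
        (ρ - z.1 ^ 2 - z.2 ^ 2)) :=
    ((gaussianBallMass_mono _).measurable.comp (by fun_prop)).ennreal_ofReal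
  rw [truncNormal_eq_smul_restrict hlam, integral_smul_measure, smul_eq_mul,
    ← integral_map (φ := fun x : Fin (k + 2) → ℝ => (x p, x (p.succAbove q))) (f := g)
      (by fun_prop) hg.aestronglyMeasurable,
    map_restrict_truncBall (fun n => (lam n).toNNReal),
    integral_withDensity_eq_integral_toReal_smul hw (.of_forall fun _ => ENNReal.ofReal_lt_top)]
  simp_rw [ENNReal.toReal_ofReal (gaussianBallMass_nonneg _ _), smul_eq_mul]

theorem covariance_sq_truncNormal_nonpos {k : ℕ} {lam : Fin (k + 2) → ℝ}
    (hlam : ∀ n, 0 < lam n) {ρ : ℝ} (hρ : 0 < ρ) (p : Fin (k + 2)) (q : Fin (k + 1)) :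
    covariance (fun x => x p ^ 2) (fun x => x (p.succAbove q) ^ 2) (truncNormal lam ρ) ≤ 0 := by
  have := isProbabilityMeasure_truncNormal hlam hρ
  rw [covariance_eq_sub (memLp_sq_truncNormal hlam hρ _) (memLp_sq_truncNormal hlam hρ _)]
  have e1 := integral_truncNormal_comp hlam (ρ := ρ) p q (g := fun _ => 1) measurable_const
  have eu := integral_truncNormal_comp hlam (ρ := ρ) p q (g := fun z => z.1 ^ 2) (by fun_prop)
  have ev := integral_truncNormal_comp hlam (ρ := ρ) p q (g := fun z => z.2 ^ 2) (by fun_prop)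
  have euv := integral_truncNormal_comp hlam (ρ := ρ) p q (g := fun z => z.1 ^ 2 * z.2 ^ 2)
    (by fun_prop)
  have key := integral_sq_mul_sq_le
    (isLogConcave_gaussianBallMass (fun i => (lam (p.succAbove (q.succAbove i))).toNNReal)
      fun i => by simpa using hlam _)
    (gaussianBallMass_nonneg _) (gaussianBallMass_le_one _) (gaussianBallMass_mono _)
    (fun r hr => gaussianBallMass_of_nonpos _ hr) hρ.le
    (gaussianReal 0 (lam p).toNNReal) (gaussianReal 0 (lam (p.succAbove q)).toNNReal)
  simp only [mul_one, integral_const, probReal_univ, smul_eq_mul] at e1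
  simp only [Pi.mul_apply]
  rw [eu, ev, euv, sub_nonpos]
  set c := (ENNReal.ofReal (truncNormalConst lam ρ)).toReal
  have hc : 0 ≤ c := ENNReal.toReal_nonneg
  -- One factor `c` normalises the total weight to one by `e1`; the others turn the weighted
  -- integrals into moments.
  have key' := mul_le_mul_of_nonneg_left key (mul_nonneg hc hc)
  rw [← mul_assoc, mul_assoc c c, ← e1, mul_one] at key'
  exact key'.trans (le_of_eq (by ring))

theorem mainTheorem2 {ν : ℕ} (lam : Fin ν → ℝ) (hlam : ∀ n, 0 < lam n) (ρ : ℝ) (hρ : 0 < ρ)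
    {Ω : Type*} [MeasurableSpace Ω] (P : Measure Ω) [IsProbabilityMeasure P]
    (X : Ω → Fin ν → ℝ) (hX : HasLaw X (truncNormal lam ρ) P)
    (n m : Fin ν) (hnm : n ≠ m) :
    MemLp (fun ω => X ω n ^ 2) 2 P ∧ MemLp (fun ω => X ω m ^ 2) 2 P ∧
      covariance (fun ω => X ω n ^ 2) (fun ω => X ω m ^ 2) P ≤ 0 := by
  have hLp : ∀ i, MemLp (fun ω => X ω i ^ 2) 2 P := fun i => by
    have h := memLp_sq_truncNormal hlam hρ i
    rw [← hX.map_eq] at h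
    exact h.comp_of_map hX.aemeasurable
  refine ⟨hLp n, hLp m, ?_⟩
  rw [hX.covariance_fun_comp (f := fun x => x n ^ 2) (g := fun x => x m ^ 2)
    ((measurable_pi_apply n).pow_const 2).aemeasurable
    ((measurable_pi_apply m).pow_const 2).aemeasurable]
  -- Distinct indices force dimension at least two, and any index other than `n` is `n.succAbove q`.
  match ν, lam, hlam, n, m, hnm with
  | 0, _, _, n, _, _ => exact n.elim0
  | 1, _, _, n, m, hnm => exact absurd (Subsingleton.elim n m) hnm
  | k + 2, lam, hlam, n, m, hnm =>
    obtain ⟨q, rfl⟩ := Fin.exists_succAbove_eq hnm.symm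
    exact covariance_sq_truncNormal_nonpos hlam hρ n q
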